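/- A generalized pentagonal number is an integer of the form $t(3t-1)/2$ with $t\in\mathbb{Z}$. Let $n$ be a positive integer. The number of representations of $n$ as the sum of a generalized pentagonal number and a positive square, or as the sum of a generalized pentagonal number and three times a positive square, that is, the number \[ \#\left\{(m,s) : m+s=n,\ m \text{ is a generalized pentagonal number},\ s\in\{k^2:k\ge 1\}\cup\{3k^2:k\ge 1\}\right\}, \] is odd if and only if $n=\frac{t(3t-1)}{2}$ for some odd integer $t$. -/

import Mathlib

/-- `m` is a generalized pentagonal number: `m = t(3t-1)/2` for some integer `t`
(zero and negative `t` allowed). -/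
def IsGeneralizedPentagonal (m : ℕ) : Prop := ∃ t : ℤ, m = pentagonal t

/-- `s` is the square of a positive integer, or three times such a square. -/
def IsSquareOrThriceSquare (s : ℕ) : Prop := ∃ k : ℕ, 1 ≤ k ∧ (s = k ^ 2 ∨ s = 3 * k ^ 2)

open Classical in
/-- The finite set of pairs `(m, s)` with `m + s = n`, where `m` is a generalized pentagonal number
and `s` is a positive square or three times a positive square. -/
noncomputable def pentagonalSquareRepresentations (n : ℕ) : Finset (ℕ × ℕ) :=
  {x ∈ Finset.HasAntidiagonal.antidiagonal n |
    IsGeneralizedPentagonal x.1 ∧ IsSquareOrThriceSquare x.2}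

/-! Put G = ∑ q^(t(3t-1)/2), E = ∑ (-1)^t q^(t(3t-1)/2), O = the part of G with t odd, and φ(q) = ∑
q^(n²), all sums over ℤ. The Jacobi triple product turns each series into a product and gives G(q)
φ(-q) = E(q) φ(-q³). Let α = ∑ q^(k²) and β = ∑ q^(3k²) over k ≥ 1. Modulo 4, signs disappear behind
a factor 2, so φ(-q) = 1 + 2α and φ(-q³) = 1 + 2β. Since G = E + 2O, the identity becomes 2G(α + β)
= 2O modulo 4, that is, G(α + β) ≡ O modulo 2. The coefficient of qⁿ on the left counts the
representations; on the right it detects odd t. Convergence is avoided by taking q nilpotent,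
finally q = X in (ℤ/4)[X]/(X^(n+1)): all sums and products are then finite. -/

/-- The triangular number `n(n+1)/2` of an integer `n`. -/
def triangular (n : ℤ) : ℕ := (n * (n + 1) / 2).toNat

theorem two_mul_natCast_triangular (n : ℤ) : 2 * (triangular n : ℤ) = n * (n + 1) := by
  have h : 0 ≤ n * (n + 1) := by
    rcases le_or_gt 0 n with h | h
    · positivity
    · exact mul_nonneg_of_nonpos_of_nonpos (by lia) (by lia)
  have h2 : n * (n + 1) / 2 * 2 = n * (n + 1) :=
    Int.ediv_mul_cancel (Int.even_mul_succ_self n).two_dvd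
  rw [triangular, Int.toNat_of_nonneg (by lia)]
  lia

theorem triangular_add_two_mul_triangular_neg (n : ℤ) :
    triangular n + 2 * triangular (-n) = pentagonal n := by
  zify
  linarith [two_mul_natCast_triangular n, two_mul_natCast_triangular (-n),
    two_mul_natCast_pentagonal n]

theorem triangular_add_triangular_neg (n : ℤ) :
    triangular n + triangular (-n) = n.natAbs ^ 2 := by
  zify
  rw [sq_abs]
  linarith [two_mul_natCast_triangular n, two_mul_natCast_triangular (-n)]

theorem le_triangular {n : ℤ} (hn : 0 ≤ n) : n ≤ triangular n := by
  nlinarith [two_mul_natCast_triangular n]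

/-! ### q-Pochhammer products and Gaussian binomials -/

section CommRing

variable {R : Type*} [CommRing R]

/-- The finite product `(1 - c)(1 - c²)⋯(1 - cᵐ)`. -/
def qPochhammer (c : R) (m : ℕ) : R := ∏ i ∈ Finset.range m, (1 - c ^ (i + 1))

theorem qPochhammer_succ (c : R) (m : ℕ) :
    qPochhammer c (m + 1) = qPochhammer c m * (1 - c ^ (m + 1)) :=
  Finset.prod_range_succ _ _

theorem isUnit_qPochhammer {c : R} (hc : IsNilpotent c) (m : ℕ) : IsUnit (qPochhammer c m) := by
  induction m with
  | zero => simp [qPochhammer]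
  | succ m ih =>
    rw [qPochhammer_succ]
    exact ih.mul (hc.pow_succ m).isUnit_one_sub

theorem qPochhammer_eq_of_le {c : R} {K m : ℕ} (hc : c ^ K = 0) (hm : K ≤ m) :
    qPochhammer c m = qPochhammer c K := by
  induction m, hm using Nat.le_induction with
  | base => rfl
  | succ m hm ih => rw [qPochhammer_succ, ih, pow_eq_zero_of_le (by lia) hc, sub_zero, mul_one]

/-- The Gaussian binomial coefficients, evaluated at `c`. -/
def gaussBinom (c : R) : ℕ → ℕ → R
  | _, 0 => 1
  | 0, _ + 1 => 0
  | m + 1, k + 1 => gaussBinom c m k + c ^ (k + 1) * gaussBinom c m (k + 1)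

@[simp]
theorem gaussBinom_zero_right (c : R) (m : ℕ) : gaussBinom c m 0 = 1 := by
  cases m <;> rfl

theorem gaussBinom_succ_succ (c : R) (m k : ℕ) :
    gaussBinom c (m + 1) (k + 1) = gaussBinom c m k + c ^ (k + 1) * gaussBinom c m (k + 1) := rfl

theorem gaussBinom_eq_zero_of_lt (c : R) {m k : ℕ} (h : m < k) : gaussBinom c m k = 0 := by
  induction m generalizing k with
  | zero => obtain ⟨k, rfl⟩ := Nat.exists_eq_succ_of_ne_zero h.ne'; rfl
  | succ m ih =>
    obtain ⟨k, rfl⟩ := Nat.exists_eq_succ_of_ne_zero (Nat.ne_zero_of_lt h)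
    rw [Nat.succ_eq_add_one, gaussBinom_succ_succ, ih (by lia), ih (by lia), mul_zero, add_zero]

theorem gaussBinom_succ_succ' (c : R) {m k : ℕ} (h : k ≤ m) :
    gaussBinom c (m + 1) (k + 1) = c ^ (m - k) * gaussBinom c m k + gaussBinom c m (k + 1) := by
  induction m generalizing k with
  | zero =>
    obtain rfl : k = 0 := by lia
    simp [gaussBinom]
  | succ m ih =>
    rcases k with _ | k
    · have h1 := ih (k := 0) (by lia)
      have h2 := gaussBinom_succ_succ c m 0
      rw [gaussBinom_succ_succ]
      simp only [gaussBinom_zero_right, Nat.sub_zero, zero_add, pow_one] at h1 h2 ⊢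
      linear_combination c * h1 - h2
    · rcases h.lt_or_eq with h' | h'
      · have h1 := ih (k := k) (by lia)
        have h2 := ih (k := k + 1) (by lia)
        have h3 := gaussBinom_succ_succ c m k
        have h4 := gaussBinom_succ_succ c m (k + 1)
        rw [gaussBinom_succ_succ c (m + 1), show m + 1 - (k + 1) = m - (k + 1) + 1 by lia]
        rw [show m - k = m - (k + 1) + 1 by lia] at h1
        linear_combination h1 + c ^ (k + 2) * h2 - c ^ (m - (k + 1) + 1) * h3 - h4
      · obtain rfl : k = m := by lia
        rw [gaussBinom_succ_succ, gaussBinom_eq_zero_of_lt c (show k + 1 < k + 1 + 1 by lia)]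
        simp

theorem gaussBinom_mul_qPochhammer (c : R) (k l : ℕ) :
    gaussBinom c (k + l) k * qPochhammer c k * qPochhammer c l = qPochhammer c (k + l) := by
  induction k generalizing l with
  | zero => simp [qPochhammer]
  | succ k ihk =>
    induction l with
    | zero =>
      have h := ihk 0
      simp only [add_zero] at h ⊢
      rw [gaussBinom_succ_succ, gaussBinom_eq_zero_of_lt c (Nat.lt_succ_self k), qPochhammer_succ]
      linear_combination (1 - c ^ (k + 1)) * h
    | succ l ihl =>
      have h := ihk (l + 1)
      rw [show k + 1 + (l + 1) = k + (l + 1) + 1 by ring, gaussBinom_succ_succ, qPochhammer_succ c k,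
        qPochhammer_succ c (k + (l + 1))]
      rw [show k + 1 + l = k + (l + 1) by ring, qPochhammer_succ c k] at ihl
      rw [qPochhammer_succ c l] at h ⊢
      linear_combination (1 - c ^ (k + 1)) * h + c ^ (k + 1) * (1 - c ^ (l + 1)) * ihl

/-! ### The Jacobi triple product -/

/-- The general term of Ramanujan's theta series `f(a, b)`. -/
def thetaTerm (a b : R) (n : ℤ) : R := a ^ triangular n * b ^ triangular (-n)

/-- Consecutive terms have ratio a(ab)ⁿ; the extra factor (ab)^j keeps exponents nonnegative when n
< 0. -/
theorem mul_pow_mul_thetaTerm (a b : R) {M j : ℕ} {n : ℤ} (h : (M : ℤ) = j + n) :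
    a * (a * b) ^ M * thetaTerm a b n = (a * b) ^ j * thetaTerm a b (n + 1) := by
  have h1 : 1 + M + triangular n = j + triangular (n + 1) := by
    zify
    linarith [two_mul_natCast_triangular n, two_mul_natCast_triangular (n + 1)]
  have h2 : M + triangular (-n) = j + triangular (-(n + 1)) := by
    zify
    linarith [two_mul_natCast_triangular (-n), two_mul_natCast_triangular (-(n + 1))]
  calc _ = a ^ (1 + M + triangular n) * b ^ (M + triangular (-n)) := by
        rw [thetaTerm]; ring
    _ = _ := by rw [h1, h2, thetaTerm]; ring

theorem thetaTerm_neg (a b : R) (n : ℤ) : thetaTerm a b (-n) = thetaTerm b a n := by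
  rw [thetaTerm, thetaTerm, neg_neg, mul_comm]

theorem mul_pow_mul_thetaTerm' (a b : R) {M j : ℕ} {n : ℤ} (h : (M : ℤ) = j - n) :
    b * (a * b) ^ M * thetaTerm a b n = (a * b) ^ j * thetaTerm a b (n - 1) := by
  have := mul_pow_mul_thetaTerm b a (M := M) (j := j) (n := -n) (by lia)
  rwa [thetaTerm_neg, show -n + 1 = -(n - 1) by ring, thetaTerm_neg, mul_comm b a] at this

theorem prod_one_add_mul_pow (a b : R) (N : ℕ) :
    ∏ i ∈ Finset.range N, (1 + b * (a * b) ^ i) =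
      ∑ k ∈ Finset.range (N + 1), gaussBinom (a * b) N k * thetaTerm a b (k - N) := by
  induction N with
  | zero => simp [thetaTerm, triangular]
  | succ N ih =>
    have hs : ∑ k ∈ Finset.range (N + 1), (a * b) ^ (k + 1) * gaussBinom (a * b) N (k + 1) *
        thetaTerm a b (k - N) + thetaTerm a b (-N - 1) =
        ∑ k ∈ Finset.range (N + 1), (a * b) ^ k * gaussBinom (a * b) N k *
          thetaTerm a b (k - N - 1) := by
      rw [Finset.sum_range_succ, gaussBinom_eq_zero_of_lt _ (Nat.lt_succ_self N),
        Finset.sum_range_succ']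
      simp only [Nat.cast_add, Nat.cast_one, mul_zero, zero_mul, add_zero, pow_zero, one_mul,
        gaussBinom_zero_right, Nat.cast_zero, zero_sub]
      congr 1
      refine Finset.sum_congr rfl fun k _ ↦ ?_
      rw [show (k : ℤ) + 1 - N - 1 = k - N by ring]
    rw [Finset.prod_range_succ, ih, Finset.sum_range_succ' _ (N + 1), mul_add, mul_one]
    have e : ∀ k ∈ Finset.range (N + 1), gaussBinom (a * b) (N + 1) (k + 1) *
        thetaTerm a b (((k + 1 : ℕ) : ℤ) - (N + 1 : ℕ)) =
        gaussBinom (a * b) N k * thetaTerm a b (k - N) +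
        (a * b) ^ (k + 1) * gaussBinom (a * b) N (k + 1) * thetaTerm a b (k - N) := by
      intro k _
      rw [gaussBinom_succ_succ, show (((k + 1 : ℕ) : ℤ) - (N + 1 : ℕ)) = k - N by push_cast; ring]
      ring
    rw [Finset.sum_congr rfl e, Finset.sum_add_distrib, add_assoc, gaussBinom_zero_right, one_mul,
      show ((0 : ℕ) : ℤ) - (N + 1 : ℕ) = -N - 1 by push_cast; ring, hs, Finset.sum_mul]
    congr 1
    refine Finset.sum_congr rfl fun k _ ↦ ?_
    have := mul_pow_mul_thetaTerm' a b (M := N) (j := k) (n := k - N) (by ring)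
    linear_combination gaussBinom (a * b) N k * this

/-- Finite triple product. Each new factor in a shifts the theta index by one, and the second Pascal
rule recombines the coefficients. -/
theorem prod_one_add_mul_pow_mul_prod (a b : R) (M N : ℕ) :
    (∏ i ∈ Finset.range M, (1 + a * (a * b) ^ i)) * ∏ i ∈ Finset.range N, (1 + b * (a * b) ^ i) =
      ∑ k ∈ Finset.range (M + N + 1), gaussBinom (a * b) (M + N) k * thetaTerm a b (k - N) := by
  induction M with
  | zero => simpa using prod_one_add_mul_pow a b N
  | succ M ih =>
    rw [Finset.prod_range_succ, mul_right_comm, ih, show M + 1 + N = M + N + 1 by ring,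
      Finset.sum_range_succ' _ (M + N + 1), mul_add, mul_one]
    have e : ∀ k ∈ Finset.range (M + N + 1), gaussBinom (a * b) (M + N + 1) (k + 1) *
        thetaTerm a b ((k + 1 : ℕ) - N) =
        gaussBinom (a * b) (M + N) (k + 1) * thetaTerm a b ((k + 1 : ℕ) - N) +
        gaussBinom (a * b) (M + N) k * thetaTerm a b (k - N) * (a * (a * b) ^ M) := by
      intro k hk
      have hk : k ≤ M + N := by simpa [Nat.lt_succ_iff] using hk
      have := mul_pow_mul_thetaTerm a b (M := M) (j := M + N - k) (n := k - N) (by lia)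
      rw [show (k : ℤ) - N + 1 = (k + 1 : ℕ) - N by push_cast; ring] at this
      rw [gaussBinom_succ_succ' _ hk]
      linear_combination -gaussBinom (a * b) (M + N) k * this
    have hs : ∑ k ∈ Finset.range (M + N + 1), gaussBinom (a * b) (M + N) k * thetaTerm a b (k - N) =
        ∑ k ∈ Finset.range (M + N + 1), gaussBinom (a * b) (M + N) (k + 1) *
          thetaTerm a b ((k + 1 : ℕ) - N) + thetaTerm a b ((0 : ℕ) - N) := by
      rw [Finset.sum_range_succ', gaussBinom_zero_right, Finset.sum_range_succ _ (M + N),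
        gaussBinom_eq_zero_of_lt _ (Nat.lt_succ_self (M + N)), zero_mul, add_zero, one_mul]
    rw [Finset.sum_congr rfl e, Finset.sum_add_distrib, Finset.sum_mul, gaussBinom_zero_right]
    linear_combination hs

theorem sum_range_sub_eq_sum_Icc (g : ℤ → R) (N : ℕ) :
    ∑ k ∈ Finset.range (N + N + 1), g (k - N) = ∑ n ∈ Finset.Icc (-N : ℤ) N, g n := by
  refine Finset.sum_bij (fun k _ ↦ (k : ℤ) - N) ?_ ?_ ?_ ?_
  · intro k hk
    simp only [Finset.mem_range, Finset.mem_Icc] at hk ⊢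
    lia
  · intro k _ l _ h
    lia
  · intro n hn
    simp only [Finset.mem_Icc] at hn
    exact ⟨(n + N).toNat, by simp only [Finset.mem_range]; lia, by lia⟩
  · simp

theorem sum_Icc_neg_eq_of_even (g : ℤ → R) (hg : ∀ n, g (-n) = g n) (N : ℕ) :
    ∑ n ∈ Finset.Icc (-N : ℤ) N, g n = g 0 + 2 * ∑ k ∈ Finset.Icc 1 N, g k := by
  induction N with
  | zero => simp
  | succ N ih =>
    have e : Finset.Icc (-(N + 1 : ℕ) : ℤ) (N + 1 : ℕ) =
        insert (-(N + 1 : ℕ) : ℤ) (insert ((N + 1 : ℕ) : ℤ) (Finset.Icc (-N : ℤ) N)) := by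
      ext x
      simp only [Finset.mem_Icc, Finset.mem_insert]
      lia
    rw [e, Finset.sum_insert, Finset.sum_insert, ih, Finset.sum_Icc_succ_top (by lia), hg]
    · ring
    · simp
    · simp only [Finset.mem_insert, Finset.mem_Icc]
      lia

theorem thetaTerm_eq_zero {a b : R} {K : ℕ} (ha : a ^ K = 0) (hb : b ^ K = 0) {n : ℤ}
    (hn : K ≤ n.natAbs) : thetaTerm a b n = 0 := by
  rcases le_total 0 n with h | h
  · have := le_triangular h
    rw [thetaTerm, pow_eq_zero_of_le (by lia) ha, zero_mul]
  · have := le_triangular (n := -n) (by lia)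
    rw [thetaTerm, pow_eq_zero_of_le (m := K) (n := triangular (-n)) (by lia) hb, mul_zero]

/-- The **Jacobi triple product** for nilpotent arguments. -/
theorem qPochhammer_mul_prod_eq_sum_thetaTerm {a b : R} {K N : ℕ} (ha : a ^ K = 0)
    (hb : b ^ K = 0) (hN : 2 * K ≤ N) :
    qPochhammer (a * b) K * ((∏ i ∈ Finset.range N, (1 + a * (a * b) ^ i)) *
      ∏ i ∈ Finset.range N, (1 + b * (a * b) ^ i)) = ∑ n ∈ Finset.Icc (-N : ℤ) N, thetaTerm a b n := by
  have hc : (a * b) ^ K = 0 := by rw [mul_pow, ha, zero_mul]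
  rw [prod_one_add_mul_pow_mul_prod, Finset.mul_sum, ← sum_range_sub_eq_sum_Icc]
  refine Finset.sum_congr rfl fun k hk ↦ ?_
  rw [Finset.mem_range] at hk
  by_cases h : K ≤ ((k : ℤ) - N).natAbs
  · simp [thetaTerm_eq_zero ha hb h]
  -- Here |k - N| < K and N ≥ 2K, so k and 2N - k are at least K. All three Pochhammer products have
  -- stabilized to the same unit, the inverse of the Gaussian binomial.
  · obtain ⟨l, hl⟩ := Nat.exists_eq_add_of_le (show k ≤ N + N by lia)
    have := gaussBinom_mul_qPochhammer (a * b) k l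
    rw [← hl, qPochhammer_eq_of_le hc (show K ≤ k by lia),
      qPochhammer_eq_of_le hc (show K ≤ l by lia),
      qPochhammer_eq_of_le hc (show K ≤ N + N by lia)] at this
    have := (isUnit_qPochhammer ⟨K, hc⟩ K).mul_right_cancel (this.trans (one_mul _).symm)
    linear_combination thetaTerm a b (k - N) * this

/-! ### Product formulas for the theta series -/

theorem prod_mul_qPochhammer_sq (q : R) (m : ℕ) :
    (∏ i ∈ Finset.range m, (1 - q * (q ^ 2) ^ i)) * qPochhammer (q ^ 2) m =
      qPochhammer q (2 * m) := by
  induction m with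
  | zero => simp [qPochhammer]
  | succ m ih =>
    rw [show 2 * (m + 1) = 2 * m + 1 + 1 by ring, qPochhammer_succ, qPochhammer_succ,
      qPochhammer_succ, ← ih, Finset.prod_range_succ]
    ring

theorem prod_mul_prod_mul_qPochhammer_cube (q : R) (m : ℕ) :
    (∏ i ∈ Finset.range m, (1 - q * (q ^ 3) ^ i)) *
      (∏ i ∈ Finset.range m, (1 - q ^ 2 * (q ^ 3) ^ i)) * qPochhammer (q ^ 3) m =
      qPochhammer q (3 * m) := by
  induction m with
  | zero => simp [qPochhammer]
  | succ m ih =>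
    rw [show 3 * (m + 1) = 3 * m + 1 + 1 + 1 by ring, qPochhammer_succ, qPochhammer_succ,
      qPochhammer_succ, qPochhammer_succ, ← ih, Finset.prod_range_succ, Finset.prod_range_succ]
    ring

theorem prod_one_add_mul_prod_one_sub (x c : R) (m : ℕ) :
    (∏ i ∈ Finset.range m, (1 + x * c ^ i)) * ∏ i ∈ Finset.range m, (1 - x * c ^ i) =
      ∏ i ∈ Finset.range m, (1 - x ^ 2 * (c ^ 2) ^ i) := by
  rw [← Finset.prod_mul_distrib]
  exact Finset.prod_congr rfl fun i _ ↦ by ring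

theorem thetaTerm_neg_self (q : R) (n : ℤ) : thetaTerm (-q) (-q) n = (-q) ^ n.natAbs ^ 2 := by
  rw [thetaTerm, ← pow_add, triangular_add_triangular_neg]

theorem thetaTerm_self_sq (q : R) (n : ℤ) : thetaTerm q (q ^ 2) n = q ^ pentagonal n := by
  rw [thetaTerm, ← pow_mul, ← pow_add, triangular_add_two_mul_triangular_neg]

theorem thetaTerm_neg_neg (a b : R) (n : ℤ) :
    thetaTerm (-a) (-b) n = (-1) ^ n.natAbs * thetaTerm a b n := by
  have h : (-1 : R) ^ n.natAbs = (-1) ^ triangular n * (-1) ^ triangular (-n) := by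
    rw [← pow_add, triangular_add_triangular_neg]
    rcases n.natAbs.even_or_odd with h | h
    · rw [h.neg_one_pow, (h.pow_of_ne_zero two_ne_zero).neg_one_pow]
    · rw [h.neg_one_pow, h.pow.neg_one_pow]
  rw [h, thetaTerm, neg_pow a, neg_pow b, thetaTerm]
  ring

section Nilpotent

variable {q : R} {K N : ℕ}

theorem pow_pow_eq_zero (hq : q ^ K = 0) {d : ℕ} (hd : d ≠ 0) : (q ^ d) ^ K = 0 := by
  rw [pow_right_comm, hq, zero_pow hd]

/-- Gauss' product formula for the theta series of the squares. -/
theorem sum_neg_pow_sq_mul_qPochhammer (hq : q ^ K = 0) (hN : 2 * K ≤ N) :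
    (∑ n ∈ Finset.Icc (-N : ℤ) N, (-q) ^ n.natAbs ^ 2) * qPochhammer (q ^ 2) K =
      qPochhammer q K ^ 2 := by
  have hq' : (-q) ^ K = 0 := by rw [neg_pow, hq, mul_zero]
  have h := qPochhammer_mul_prod_eq_sum_thetaTerm hq' hq' hN
  have h2 := prod_mul_qPochhammer_sq q N
  rw [qPochhammer_eq_of_le hq (by lia), qPochhammer_eq_of_le (pow_pow_eq_zero hq two_ne_zero)
    (show K ≤ N by lia)] at h2
  rw [show -q * -q = q ^ 2 by ring] at h
  simp only [thetaTerm_neg_self, neg_mul, ← sub_eq_add_neg] at h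
  rw [← h, ← h2]
  ring

/-- Euler's pentagonal number theorem for nilpotent arguments. -/
theorem sum_neg_one_pow_mul_pow_pentagonal (hq : q ^ K = 0) (hN : 2 * K ≤ N) :
    ∑ n ∈ Finset.Icc (-N : ℤ) N, (-1) ^ n.natAbs * q ^ pentagonal n = qPochhammer q K := by
  have h := qPochhammer_mul_prod_eq_sum_thetaTerm (a := -q) (b := -q ^ 2)
    (by rw [neg_pow, hq, mul_zero]) (by rw [neg_pow, pow_pow_eq_zero hq two_ne_zero, mul_zero]) hN
  have h2 := prod_mul_prod_mul_qPochhammer_cube q N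
  rw [qPochhammer_eq_of_le hq (by lia), qPochhammer_eq_of_le (pow_pow_eq_zero hq three_ne_zero)
    (show K ≤ N by lia)] at h2
  rw [show -q * -q ^ 2 = q ^ 3 by ring] at h
  simp only [thetaTerm_neg_neg, thetaTerm_self_sq, neg_mul, ← sub_eq_add_neg] at h
  rw [← h, ← h2]
  ring

/-- Triple product at (q, q²), with each 1 + x rewritten as (1 - x²)/(1 - x). -/
theorem sum_pow_pentagonal_mul_qPochhammer (hq : q ^ K = 0) (hN : 2 * K ≤ N) :
    (∑ n ∈ Finset.Icc (-N : ℤ) N, q ^ pentagonal n) *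
      (qPochhammer q K * qPochhammer (q ^ 6) K) =
      qPochhammer (q ^ 3) K ^ 2 * qPochhammer (q ^ 2) K := by
  have hq2 := pow_pow_eq_zero hq two_ne_zero
  have h := qPochhammer_mul_prod_eq_sum_thetaTerm hq hq2 hN
  have h1 := prod_mul_prod_mul_qPochhammer_cube q N
  have h2 := prod_mul_prod_mul_qPochhammer_cube (q ^ 2) N
  have e : (q ^ 2) ^ 3 = (q ^ 3) ^ 2 := by ring
  have e6 : (q ^ 3) ^ 2 = q ^ 6 := by ring
  rw [qPochhammer_eq_of_le hq (by lia), qPochhammer_eq_of_le (pow_pow_eq_zero hq three_ne_zero)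
    (show K ≤ N by lia)] at h1
  rw [e, ← prod_one_add_mul_prod_one_sub, ← prod_one_add_mul_prod_one_sub, e6,
    qPochhammer_eq_of_le hq2 (by lia), qPochhammer_eq_of_le (pow_pow_eq_zero hq (by simp))
    (show K ≤ N by lia)] at h2
  simp only [thetaTerm_self_sq, ← pow_succ'] at h
  rw [← h, ← h1, ← h2]
  ring

/-- Writing (x) for the Pochhammer product in x, both sides equal (q)(q³)²/(q⁶). -/
theorem sum_pow_pentagonal_mul_sum_neg_pow_sq (hq : q ^ K = 0) (hN : 2 * K ≤ N) :
    (∑ n ∈ Finset.Icc (-N : ℤ) N, q ^ pentagonal n) *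
        ∑ n ∈ Finset.Icc (-N : ℤ) N, (-q) ^ n.natAbs ^ 2 =
      (∑ n ∈ Finset.Icc (-N : ℤ) N, (-1) ^ n.natAbs * q ^ pentagonal n) *
        ∑ n ∈ Finset.Icc (-N : ℤ) N, (-q ^ 3) ^ n.natAbs ^ 2 := by
  have hG := sum_pow_pentagonal_mul_qPochhammer hq hN
  have hA := sum_neg_pow_sq_mul_qPochhammer hq hN
  have hB := sum_neg_pow_sq_mul_qPochhammer (pow_pow_eq_zero hq three_ne_zero) hN
  rw [show (q ^ 3) ^ 2 = q ^ 6 by ring] at hB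
  rw [sum_neg_one_pow_mul_pow_pentagonal hq hN]
  have hu {d : ℕ} (hd : d ≠ 0) : IsUnit (qPochhammer (q ^ d) K) :=
    isUnit_qPochhammer ⟨K, pow_pow_eq_zero hq hd⟩ K
  refine (((isUnit_qPochhammer ⟨K, hq⟩ K).mul (hu (d := 6) (by simp))).mul
    (hu two_ne_zero)).mul_right_cancel ?_
  generalize (∑ n ∈ Finset.Icc (-N : ℤ) N, q ^ pentagonal n) = G at *
  generalize (∑ n ∈ Finset.Icc (-N : ℤ) N, (-q) ^ n.natAbs ^ 2) = A at *
  generalize (∑ n ∈ Finset.Icc (-N : ℤ) N, (-q ^ 3) ^ n.natAbs ^ 2) = B at *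
  linear_combination A * qPochhammer (q ^ 2) K * hG +
    qPochhammer (q ^ 3) K ^ 2 * qPochhammer (q ^ 2) K * hA -
    qPochhammer q K ^ 2 * qPochhammer (q ^ 2) K * hB

/-! ### Reduction modulo 4 -/

theorem two_mul_neg_pow_of_four_eq_zero (h4 : (4 : R) = 0) (x : R) (m : ℕ) :
    2 * (-x) ^ m = 2 * x ^ m := by
  rcases m.even_or_odd with h | h
  · rw [h.neg_pow]
  · rw [h.neg_pow]
    linear_combination -x ^ m * h4

theorem sum_neg_pow_sq_eq (h4 : (4 : R) = 0) (x : R) (N : ℕ) :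
    ∑ n ∈ Finset.Icc (-N : ℤ) N, (-x) ^ n.natAbs ^ 2 =
      1 + 2 * ∑ k ∈ Finset.Icc 1 N, x ^ k ^ 2 := by
  rw [sum_Icc_neg_eq_of_even _ (by simp), Finset.mul_sum, Finset.mul_sum]
  simp [two_mul_neg_pow_of_four_eq_zero h4]

theorem sum_pow_pentagonal_eq (N : ℕ) (q : R) :
    ∑ n ∈ Finset.Icc (-N : ℤ) N, q ^ pentagonal n =
      ∑ n ∈ Finset.Icc (-N : ℤ) N, (-1) ^ n.natAbs * q ^ pentagonal n +
      2 * ∑ n ∈ Finset.Icc (-N : ℤ) N with Odd n, q ^ pentagonal n := by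
  rw [Finset.sum_filter, Finset.mul_sum, ← Finset.sum_add_distrib]
  refine Finset.sum_congr rfl fun n _ ↦ ?_
  split_ifs with h
  · rw [(Int.natAbs_odd.mpr h).neg_one_pow]
    ring
  · rw [(Int.natAbs_even.mpr (Int.not_odd_iff_even.mp h)).neg_one_pow]
    ring

theorem two_mul_sum_pow_pentagonal_mul (h4 : (4 : R) = 0) (hq : q ^ K = 0) (hN : 2 * K ≤ N) :
    2 * ((∑ n ∈ Finset.Icc (-N : ℤ) N, q ^ pentagonal n) *
        ∑ k ∈ Finset.Icc 1 N, (q ^ k ^ 2 + q ^ (3 * k ^ 2))) =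
      2 * ∑ n ∈ Finset.Icc (-N : ℤ) N with Odd n, q ^ pentagonal n := by
  have h := sum_pow_pentagonal_mul_sum_neg_pow_sq hq hN
  have hu : IsUnit (∑ n ∈ Finset.Icc (-N : ℤ) N, (-q) ^ n.natAbs ^ 2) := by
    refine isUnit_of_mul_isUnit_left (y := qPochhammer (q ^ 2) K) ?_
    rw [sum_neg_pow_sq_mul_qPochhammer hq hN]
    exact (isUnit_qPochhammer ⟨K, hq⟩ K).pow 2
  rw [sum_neg_pow_sq_eq h4] at h hu
  rw [sum_neg_pow_sq_eq h4] at h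
  have hG := sum_pow_pentagonal_eq N q
  rw [Finset.sum_add_distrib]
  simp only [← pow_mul] at h
  refine hu.mul_left_cancel ?_
  generalize (∑ n ∈ Finset.Icc (-N : ℤ) N, q ^ pentagonal n) = G at *
  generalize (∑ n ∈ Finset.Icc (-N : ℤ) N, (-1) ^ n.natAbs * q ^ pentagonal n) = E at *
  generalize (∑ k ∈ Finset.Icc 1 N, q ^ k ^ 2) = α at *
  generalize (∑ k ∈ Finset.Icc 1 N, q ^ (3 * k ^ 2)) = β at *
  generalize (∑ n ∈ Finset.Icc (-N : ℤ) N with Odd n, q ^ pentagonal n) = O at *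
  linear_combination (1 + 2 * α) * hG - h + 2 * (α + β) * hG +
    (E * α + O * (α + β) + α * G * (α + β)) * h4

end Nilpotent

end CommRing

/-! ### Counting representations and comparing coefficients -/

theorem natAbs_le_pentagonal (t : ℤ) : t.natAbs ≤ pentagonal t := by
  have h := two_mul_natCast_pentagonal t
  have h1 : |t| ≤ t ^ 2 := by
    rw [← sq_abs]
    rcases eq_or_lt_of_le (abs_nonneg t) with h | h <;> nlinarith
  have h2 : t ≤ |t| := le_abs_self t
  zify
  nlinarith

theorem three_mul_sq_ne_sq {k : ℕ} (hk : k ≠ 0) (l : ℕ) : k ^ 2 ≠ 3 * l ^ 2 := by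
  intro h
  have hl : l ≠ 0 := by
    rintro rfl
    simp at h
    exact hk h
  have := congrArg (padicValNat 3) h
  rw [padicValNat.mul (by simp) (by simpa), padicValNat.pow _ _, padicValNat.pow _ _,
    padicValNat.self (by simp)] at this
  lia

/-- No pair is counted twice: t and k are determined by the pair, and a positive square is never
three times a square. -/
theorem card_pentagonalSquareRepresentations {n N : ℕ} (hN : n ≤ N) :
    (pentagonalSquareRepresentations n).card =
      ∑ t ∈ Finset.Icc (-N : ℤ) N, ∑ k ∈ Finset.Icc 1 N,
        ((if pentagonal t + k ^ 2 = n then 1 else 0) +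
          if pentagonal t + 3 * k ^ 2 = n then 1 else 0) := by
  classical
  simp only [Finset.sum_add_distrib]
  rw [← Finset.sum_product', ← Finset.sum_product', ← Finset.card_filter, ← Finset.card_filter]
  set P := Finset.Icc (-N : ℤ) N ×ˢ Finset.Icc 1 N
  have h1 : (({p ∈ P | pentagonal p.1 + p.2 ^ 2 = n}).image
      fun p ↦ (pentagonal p.1, p.2 ^ 2)).card = ({p ∈ P | pentagonal p.1 + p.2 ^ 2 = n}).card := by
    refine Finset.card_image_of_injective _ fun p p' h ↦ ?_
    simp only [Prod.mk.injEq, pentagonal_inj] at h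
    exact Prod.ext h.1 (Nat.pow_left_injective two_ne_zero h.2)
  have h2 : (({p ∈ P | pentagonal p.1 + 3 * p.2 ^ 2 = n}).image
      fun p ↦ (pentagonal p.1, 3 * p.2 ^ 2)).card =
      ({p ∈ P | pentagonal p.1 + 3 * p.2 ^ 2 = n}).card := by
    refine Finset.card_image_of_injective _ fun p p' h ↦ ?_
    simp only [Prod.mk.injEq, pentagonal_inj] at h
    exact Prod.ext h.1 (Nat.pow_left_injective two_ne_zero (by simpa using h.2))
  rw [← h1, ← h2, ← Finset.card_union_of_disjoint]
  · congr 1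
    ext ⟨m, s⟩
    rw [pentagonalSquareRepresentations, Finset.mem_filter]
    simp only [IsGeneralizedPentagonal, IsSquareOrThriceSquare, Finset.mem_filter,
      Finset.HasAntidiagonal.mem_antidiagonal, Finset.mem_union, Finset.mem_image,
      Prod.mk.injEq, Prod.exists, P, Finset.mem_product, Finset.mem_Icc]
    constructor
    · rintro ⟨rfl, ⟨t, rfl⟩, k, hk, rfl | rfl⟩
      · have := natAbs_le_pentagonal t
        have : k ≤ k ^ 2 := Nat.le_self_pow two_ne_zero k
        exact .inl ⟨t, k, ⟨⟨⟨by lia, by lia⟩, by lia, by lia⟩, rfl⟩, rfl, rfl⟩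
      · have := natAbs_le_pentagonal t
        have : k ≤ k ^ 2 := Nat.le_self_pow two_ne_zero k
        exact .inr ⟨t, k, ⟨⟨⟨by lia, by lia⟩, by lia, by lia⟩, rfl⟩, rfl, rfl⟩
    · rintro (⟨t, k, ⟨⟨-, hk, -⟩, rfl⟩, rfl, rfl⟩ | ⟨t, k, ⟨⟨-, hk, -⟩, rfl⟩, rfl, rfl⟩)
      · exact ⟨rfl, ⟨t, rfl⟩, k, hk, .inl rfl⟩
      · exact ⟨rfl, ⟨t, rfl⟩, k, hk, .inr rfl⟩
  · rw [Finset.disjoint_left]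
    simp only [Finset.mem_image, Finset.mem_filter, P, Finset.mem_product, Finset.mem_Icc]
    rintro _ ⟨p, ⟨⟨-, hp, -⟩, -⟩, rfl⟩ ⟨p', -, h⟩
    simp only [Prod.mk.injEq] at h
    exact three_mul_sq_ne_sq (by lia) _ h.2.symm

theorem sum_odd_pentagonal_eq {n N : ℕ} (hN : n ≤ N)
    [Decidable (∃ t : ℤ, Odd t ∧ n = pentagonal t)] :
    ∑ t ∈ Finset.Icc (-N : ℤ) N with Odd t, (if pentagonal t = n then 1 else 0) =
      if ∃ t : ℤ, Odd t ∧ n = pentagonal t then 1 else 0 := by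
  split_ifs with h
  · obtain ⟨t, ht, rfl⟩ := h
    have := natAbs_le_pentagonal t
    simp only [pentagonal_inj]
    rw [Finset.sum_ite_eq', if_pos]
    simp only [Finset.mem_filter, Finset.mem_Icc]
    exact ⟨by lia, ht⟩
  · refine Finset.sum_eq_zero fun t ht ↦ if_neg fun e ↦ h ⟨t, (Finset.mem_filter.mp ht).2, e.symm⟩

open Polynomial in
-- Doubled values in ℤ/4 record exactly the parity.
theorem two_mul_card_pentagonalSquareRepresentations (n : ℕ)
    [Decidable (∃ t : ℤ, Odd t ∧ n = pentagonal t)] :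
    2 * ((pentagonalSquareRepresentations n).card : ZMod 4) =
      2 * ((if ∃ t : ℤ, Odd t ∧ n = pentagonal t then 1 else 0 : ℕ) : ZMod 4) := by
  let I : Ideal (ZMod 4)[X] := Ideal.span {X ^ (n + 1)}
  let q : (ZMod 4)[X] ⧸ I := Ideal.Quotient.mk I X
  have hq : q ^ (n + 1) = 0 := by
    rw [← map_pow, Ideal.Quotient.eq_zero_iff_mem]
    exact Ideal.mem_span_singleton_self _
  have h4 : (4 : (ZMod 4)[X] ⧸ I) = 0 := by
    have := congrArg (Ideal.Quotient.mk I) (CharP.cast_eq_zero (ZMod 4)[X] 4)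
    rwa [map_natCast, map_zero] at this
  have h := two_mul_sum_pow_pentagonal_mul h4 hq le_rfl
  have hN : n ≤ 2 * (n + 1) := by lia
  rw [card_pentagonalSquareRepresentations hN, ← sum_odd_pentagonal_eq hN]
  generalize 2 * (n + 1) = N at h
  simp only [q, ← map_pow, ← map_add, ← map_sum, ← map_mul, ← map_ofNat (Ideal.Quotient.mk I) 2]
    at h
  -- Equality modulo X^(n+1) still determines the coefficient of Xⁿ.
  rw [Ideal.Quotient.eq, Ideal.mem_span_singleton, X_pow_dvd_iff] at h
  have h := h n (Nat.lt_succ_self n)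
  rw [coeff_sub, sub_eq_zero, Finset.sum_mul_sum] at h
  simpa [mul_add, ← pow_add, coeff_ofNat_mul, finsetSum_coeff, coeff_X_pow, eq_comm (a := n)]
    using h

theorem mainTheorem11 (n : ℕ) (hn : 0 < n) :
    Odd (pentagonalSquareRepresentations n).card ↔
      ∃ t : ℤ, Odd t ∧ n = pentagonal t := by
  classical
  have h := two_mul_card_pentagonalSquareRepresentations n
  norm_cast at h
  rw [ZMod.natCast_eq_natCast_iff, Nat.ModEq] at h
  rw [Nat.odd_iff]
  split_ifs at h with ht <;> simp only [ht, iff_true, iff_false] <;> lia
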